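/- Let $n\ge 1$ and let $C_2^n=\{0,1\}^n$ be the set of binary $n$-tuples, on which the symmetric group $S_n$ acts by permuting coordinates. Let $K$ be the transition matrix of the Burnside process of this action: from $x$, choose $s$ uniformly in the stabilizer $G_x\subseteq S_n$ of $x$, then choose $y$ uniformly in the set $F_s\subseteq C_2^n$ of tuples fixed by $s$, so that $$K(x,y)=\frac{1}{|G_x|}\sum_{s\in G_x\cap G_y}\frac{1}{|F_s|},\qquad x,y\in C_2^n.$$ Let $K$ act on functions $f:C_2^n\to\mathbb R$ by $(Kf)(x)=\sum_y K(x,y)f(y)$. Then: 1. The eigenvalues of $K$ are exactly $0$ and the nonzero numbers $\beta_k=\dfrac{1}{2^{4k}}\dbinom{2k}{k}^2$, $0\le k\le\lfloor n/2\rfloor$. 2. The eigenvalue $0$ has multiplicity $2^{n-1}$, and $\beta_k$ has multiplicity $\binom{n}{2k}$ for every $0\le k\le\lfloor n/2\rfloor$ (both as dimension of the eigenspace and as multiplicity in the characteristic polynomial). 3. For every $0\le k\le\lfloor n/2\rfloor$, the functions $$f_S(x)=(-1)^{|x_S|}\binom{2k}{|x_S|},\qquad S\subseteq\{1,\dots,n\},\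 |S|=2k,$$ form a basis of the $\beta_k$-eigenspace of $K$, where $|x_S|$ denotes the number of ones of $x$ among the coordinates in $S$. -/

import Mathlib

open scoped Classical in
/-- The transition matrix of the Burnside process of a finite group `G` acting on a finite
set `X`: from `x`, choose `s` uniformly in the stabilizer of `x`, and then choose `y` uniformly
among the points fixed by `s`. Thus
`K(x, y) = |G_x|⁻¹ * ∑_{s ∈ G_x ∩ G_y} |X_s|⁻¹`. -/
noncomputable def burnsideMatrix (G X : Type*) [Group G] [Fintype G] [MulAction G X] :
    Matrix X X ℝ :=
  Matrix.of fun x y =>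
    (1 / (Nat.card (MulAction.stabilizer G x) : ℝ)) *
      ∑ s : G with s • x = x ∧ s • y = y, 1 / (Nat.card (MulAction.fixedBy X s) : ℝ)

/-- The transition matrix of the binary Burnside process: the Burnside process of the symmetric
group `S_n` permuting the coordinates of the binary `n`-tuples, `(s • x) i = x (s⁻¹ i)`. -/
noncomputable def binaryBurnside (n : ℕ) : Matrix (Fin n → Fin 2) (Fin n → Fin 2) ℝ :=
  letI : MulAction (Equiv.Perm (Fin n)) (Fin n → Fin 2) := arrowAction
  burnsideMatrix (Equiv.Perm (Fin n)) (Fin n → Fin 2)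

/-- `β_k = C(2k, k)² / 2^(4k)`. -/
noncomputable def burnsideEigenvalue (k : ℕ) : ℝ :=
  ((2 * k).choose k : ℝ) ^ 2 / 2 ^ (4 * k)

/-- `|x_S|`: the number of ones of `x` among the coordinates in `S`. -/
def onesIn {n : ℕ} (x : Fin n → Fin 2) (S : Finset (Fin n)) : ℕ :=
  (S.filter fun i => x i = 1).card

/-! A uniform `s`-invariant tuple is a fair coin toss on each cycle of `s`, so it is 1 on `T` with
probability 2^(-number of cycles meeting `T`). The stabilizer of `x` is the product of the symmetric
groups on its zeros and its ones. Building a random element by inserting one point at a time turns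
the mean of that probability into c_a c_b, where a and b count the zeros and ones of `x` in `T`
(`binaryBurnside_mulVec_ones`). Summing over the d-subsets of `S` gives the binomial moments of
|y_S|. They are those of I + J, with I and J independent discrete arcsine variables on {0, …, |x_S|}
and {0, …, |S| - |x_S|}, so |x_S| is itself a Markov chain (`binaryBurnside_mulVec_comp_onesIn`).

On {0, …, m} this chain is symmetric and does not raise the degree of a polynomial. Hence it
preserves the line orthogonal to the polynomials of degree < m, spanned by j ↦ (-1)^j C(m, j). The
eigenvalue is read off at the endpoint j = m; for m = 2k it is (2k)! times a coefficient of
I_0(x/2)^2, which is β_k (`arcsineAvg_alternating_choose`). So each f_S is an eigenfunction.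

For fixed |S| the f_S are independent, and functions odd under complementation lie in the kernel.
Since the C(n, 2k) sum to 2^(n-1), these lower bounds fill the whole space. The eigenvalues being
distinct, every bound is an equality (`charpoly_eq_prod_of_le_finrank_eigenspace`). -/

open Finset

/-! ### Arcsine moments and binomial moments of the discrete arcsine law -/

/-- `c_i = C(2i, i) / 4^i`, the `i`-th moment of the arcsine law on `[0, 1]`. -/
noncomputable def arcsineMoment (i : ℕ) : ℝ := (i.centralBinom : ℝ) / 4 ^ i

theorem arcsineMoment_zero : arcsineMoment 0 = 1 := by simp [arcsineMoment]

theorem arcsineMoment_pos (i : ℕ) : 0 < arcsineMoment i := by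
  have := Nat.centralBinom_pos i
  unfold arcsineMoment
  positivity

theorem arcsineMoment_succ (i : ℕ) :
    ((i : ℝ) + 1) * arcsineMoment (i + 1) = (i + 1 / 2) * arcsineMoment i := by
  have h : ((i : ℝ) + 1) * ((i + 1).centralBinom : ℝ) = 2 * (2 * i + 1) * (i.centralBinom : ℝ) := by
    exact_mod_cast Nat.succ_mul_centralBinom_succ i
  unfold arcsineMoment
  rw [← mul_div_assoc, h, pow_succ]
  field_simp
  ring

theorem burnsideEigenvalue_eq (k : ℕ) : burnsideEigenvalue k = arcsineMoment k ^ 2 := by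
  unfold burnsideEigenvalue arcsineMoment
  rw [Nat.centralBinom_eq_two_mul_choose, div_pow, ← pow_mul, show 4 * k = 2 * (k * 2) by ring,
    pow_mul 2 2]
  norm_num

theorem burnsideEigenvalue_pos (k : ℕ) : 0 < burnsideEigenvalue k := by
  rw [burnsideEigenvalue_eq]
  exact pow_pos (arcsineMoment_pos k) 2

theorem arcsineMoment_strictAnti : StrictAnti arcsineMoment := by
  refine strictAnti_nat_of_succ_lt fun i => ?_
  have h := arcsineMoment_succ i
  have := arcsineMoment_pos i
  have : (0 : ℝ) ≤ i := i.cast_nonneg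
  nlinarith

theorem burnsideEigenvalue_strictAnti : StrictAnti burnsideEigenvalue := fun i j h => by
  rw [burnsideEigenvalue_eq, burnsideEigenvalue_eq]
  exact pow_lt_pow_left₀ (arcsineMoment_strictAnti h) (arcsineMoment_pos j).le two_ne_zero

/-- Binomial moments of the discrete arcsine law `i ↦ c_i c_{a - i}` on `{0, …, a}`. -/
theorem sum_arcsineMoment_mul_choose (a e : ℕ) :
    ∑ p ∈ antidiagonal a, arcsineMoment p.1 * arcsineMoment p.2 * (p.1.choose e : ℝ) =
      a.choose e * arcsineMoment e := by
  induction a generalizing e with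
  | zero => cases e <;> simp [arcsineMoment_zero]
  | succ a ih =>
    -- Write a + 1 as the sum of the two indices and absorb each index by the recurrence for c_i,
    -- which lowers the antidiagonal by one.
    have hsplit : ((a : ℝ) + 1) * ∑ p ∈ antidiagonal (a + 1),
        arcsineMoment p.1 * arcsineMoment p.2 * (p.1.choose e : ℝ) =
        ∑ p ∈ antidiagonal a, (((p.1 : ℝ) + 1 / 2) * arcsineMoment p.1 * arcsineMoment p.2 *
          ((p.1 + 1).choose e : ℝ) +
          ((p.2 : ℝ) + 1 / 2) * arcsineMoment p.1 * arcsineMoment p.2 * (p.1.choose e : ℝ)) := by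
      have : ((a : ℝ) + 1) * ∑ p ∈ antidiagonal (a + 1),
          arcsineMoment p.1 * arcsineMoment p.2 * (p.1.choose e : ℝ) =
          ∑ p ∈ antidiagonal (a + 1),
            (p.1 : ℝ) * (arcsineMoment p.1 * arcsineMoment p.2 * (p.1.choose e : ℝ)) +
          ∑ p ∈ antidiagonal (a + 1),
            (p.2 : ℝ) * (arcsineMoment p.1 * arcsineMoment p.2 * (p.1.choose e : ℝ)) := by
        rw [mul_sum, ← sum_add_distrib]
        refine sum_congr rfl fun p hp => ?_
        have : (p.1 : ℝ) + p.2 = a + 1 := by exact_mod_cast HasAntidiagonal.mem_antidiagonal.1 hp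
        rw [← this]; ring
      rw [this, Nat.sum_antidiagonal_succ, Nat.sum_antidiagonal_succ', sum_add_distrib]
      simp only [Nat.cast_zero, zero_mul, zero_add]
      congr 1 <;> refine sum_congr rfl fun p _ => ?_ <;> push_cast
      · linear_combination (arcsineMoment p.2 * ((p.1 + 1).choose e : ℝ)) * arcsineMoment_succ p.1
      · linear_combination (arcsineMoment p.1 * (p.1.choose e : ℝ)) * arcsineMoment_succ p.2
    have ha : (a : ℝ) + 1 ≠ 0 := by positivity
    apply mul_left_cancel₀ ha
    rw [hsplit]
    cases e with
    | zero =>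
      have h0 := ih 0
      simp only [Nat.choose_zero_right, Nat.cast_one, mul_one, one_mul] at h0 ⊢
      rw [← h0, mul_sum]
      refine sum_congr rfl fun p hp => ?_
      have : (p.1 : ℝ) + p.2 = a := by exact_mod_cast HasAntidiagonal.mem_antidiagonal.1 hp
      rw [← this]; ring
    | succ e =>
      have h1 := ih (e + 1)
      have h2 := ih e
      have key : ∀ i : ℕ, (i : ℝ) * (i.choose e : ℝ) =
          (e + 1) * (i.choose (e + 1) : ℝ) + e * (i.choose e : ℝ) := by
        intro i
        have h := Nat.choose_succ_right_eq i e
        rcases le_or_gt e i with hei | hei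
        · have h' : (i.choose (e + 1) : ℝ) * (e + 1) = i.choose e * (i - e) := by
            rw [← Nat.cast_sub hei]; exact_mod_cast h
          linear_combination -h'
        · simp [Nat.choose_eq_zero_of_lt hei, Nat.choose_eq_zero_of_lt (Nat.lt_succ_of_lt hei)]
      have hsum : ∑ p ∈ antidiagonal a, (((p.1 : ℝ) + 1 / 2) * arcsineMoment p.1 *
          arcsineMoment p.2 * ((p.1 + 1).choose (e + 1) : ℝ) +
          ((p.2 : ℝ) + 1 / 2) * arcsineMoment p.1 * arcsineMoment p.2 *
            (p.1.choose (e + 1) : ℝ)) =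
          ((a : ℝ) + 1 + (e + 1)) * (a.choose (e + 1) * arcsineMoment (e + 1)) +
          ((e : ℝ) + 1 / 2) * (a.choose e * arcsineMoment e) := by
        rw [← h1, ← h2, mul_sum, mul_sum, ← sum_add_distrib]
        refine sum_congr rfl fun p hp => ?_
        have : (p.1 : ℝ) + p.2 = a := by exact_mod_cast HasAntidiagonal.mem_antidiagonal.1 hp
        rw [Nat.choose_succ_succ, ← this]
        push_cast
        linear_combination (arcsineMoment p.1 * arcsineMoment p.2) * key p.1
      rw [hsum]
      have h3 := arcsineMoment_succ e
      have h4 : ((a : ℝ) + 1) * (a.choose e : ℝ) = ((a + 1).choose (e + 1) : ℝ) * (e + 1) := by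
        exact_mod_cast Nat.add_one_mul_choose_eq a e
      rw [Nat.choose_succ_succ] at h4 ⊢
      push_cast at h4 ⊢
      linear_combination (-(a.choose e : ℝ)) * h3 - arcsineMoment (e + 1) * h4

/-! ### The alternating convolution that evaluates β_k -/

/-- `u_i = c_i / i!`, the coefficients of `e^{x/2} I_0(x/2)`. -/
noncomputable def arcsineCoeff (i : ℕ) : ℝ := arcsineMoment i / i.factorial

theorem arcsineCoeff_succ (i : ℕ) :
    ((i : ℝ) + 1) ^ 2 * arcsineCoeff (i + 1) = (i + 1 / 2) * arcsineCoeff i := by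
  have h := arcsineMoment_succ i
  have : (i.factorial : ℝ) ≠ 0 := by exact_mod_cast i.factorial_ne_zero
  unfold arcsineCoeff
  rw [Nat.factorial_succ]
  push_cast
  field_simp
  linear_combination 2 * h

/-- Weighted alternating self-convolution of `arcsineCoeff`. -/
noncomputable def altConv (N : ℕ) (q : ℝ → ℝ → ℝ) : ℝ :=
  ∑ p ∈ antidiagonal N, (-1) ^ p.1 * q p.1 p.2 * (arcsineCoeff p.1 * arcsineCoeff p.2)

theorem altConv_congr {N : ℕ} {q r : ℝ → ℝ → ℝ} (h : ∀ i j : ℝ, i + j = N → q i j = r i j) :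
    altConv N q = altConv N r := by
  refine sum_congr rfl fun p hp => ?_
  rw [h _ _ (by exact_mod_cast HasAntidiagonal.mem_antidiagonal.1 hp)]

theorem altConv_add (N : ℕ) (q r : ℝ → ℝ → ℝ) :
    altConv N (fun i j => q i j + r i j) = altConv N q + altConv N r := by
  unfold altConv
  rw [← sum_add_distrib]
  exact sum_congr rfl fun p _ => by ring

theorem altConv_mul (N : ℕ) (t : ℝ) (q : ℝ → ℝ → ℝ) :
    altConv N (fun i j => t * q i j) = t * altConv N q := by
  unfold altConv
  rw [mul_sum]
  exact sum_congr rfl fun p _ => by ring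

theorem altConv_succ_sq_left (N : ℕ) (q : ℝ → ℝ → ℝ) :
    altConv (N + 1) (fun i j => i ^ 2 * q i j) =
      altConv N fun i j => -((i + 1 / 2) * q (i + 1) j) := by
  unfold altConv
  rw [Nat.sum_antidiagonal_succ]
  simp only [Nat.cast_zero, ne_eq, OfNat.ofNat_ne_zero, not_false_eq_true, zero_pow, zero_mul,
    mul_zero, zero_add]
  refine sum_congr rfl fun p _ => ?_
  push_cast
  rw [pow_succ]
  linear_combination (-(-1) ^ p.1 * q (p.1 + 1) p.2 * arcsineCoeff p.2) * arcsineCoeff_succ p.1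

theorem altConv_succ_sq_right (N : ℕ) (q : ℝ → ℝ → ℝ) :
    altConv (N + 1) (fun i j => j ^ 2 * q i j) =
      altConv N fun i j => (j + 1 / 2) * q i (j + 1) := by
  unfold altConv
  rw [Nat.sum_antidiagonal_succ']
  simp only [Nat.cast_zero, ne_eq, OfNat.ofNat_ne_zero, not_false_eq_true, zero_pow, zero_mul,
    mul_zero, zero_add]
  refine sum_congr rfl fun p _ => ?_
  push_cast
  linear_combination ((-1) ^ p.1 * q p.1 (p.2 + 1) * arcsineCoeff p.1) * arcsineCoeff_succ p.2

/-- The generating function is e^{x/2} I_0(x/2) · e^{-x/2} I_0(x/2) = I_0(x/2)^2, and this is its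
third-order differential equation on coefficients. A weight divisible by i^2 or j^2 lowers N, so the
proof expresses the weights through i^2 and j^2 using that i + j is constant. -/
theorem altConv_add_two (N : ℕ) :
    ((N : ℝ) + 2) ^ 3 * altConv (N + 2) (fun _ _ => 1) =
      (N + 1) * altConv N (fun _ _ => 1) := by
  have hs2 : altConv (N + 2) (fun i j => i ^ 2 * 1 + j ^ 2 * 1) =
      altConv (N + 1) fun i j => j - i := by
    rw [altConv_add, altConv_succ_sq_left, altConv_succ_sq_right, ← altConv_add]
    exact altConv_congr fun i j _ => by ring
  have hs3 : altConv (N + 2) (fun i j => i ^ 2 * i + j ^ 2 * j) =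
      altConv (N + 1) fun i j => ((N : ℝ) + 5 / 2) * (j - i) := by
    rw [altConv_add, altConv_succ_sq_left, altConv_succ_sq_right, ← altConv_add]
    refine altConv_congr fun i j h => ?_
    push_cast at h
    linear_combination (j - i) * h
  -- With s = i + j, i^3 + j^3 = (3/2) s (i^2 + j^2) - s^3/2; the last term produces the factor (N +
  -- 2)^3.
  have hcube : altConv (N + 2) (fun i j => i ^ 2 * i + j ^ 2 * j) =
      altConv (N + 2) (fun i j => ((N : ℝ) + 2) * (3 / 2) * (i ^ 2 * 1 + j ^ 2 * 1) +
        (-(((N : ℝ) + 2) ^ 3 / 2)) * 1) := by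
    refine altConv_congr fun i j h => ?_
    push_cast at h
    rw [← h]; ring
  have hd : altConv (N + 1) (fun i j => ((N : ℝ) + 1) ^ 2 * (j - i)) =
      altConv N fun _ _ => ((N : ℝ) + 1) ^ 2 * 1 := by
    -- Here (i + j)^2 (j - i) = (i + j)(j^2 - i^2).
    have : altConv (N + 1) (fun i j => ((N : ℝ) + 1) ^ 2 * (j - i)) =
        altConv (N + 1) (fun i j => i ^ 2 * (-(i + j)) + j ^ 2 * (i + j)) := by
      refine altConv_congr fun i j h => ?_
      push_cast at h
      rw [← h]; ring
    rw [this, altConv_add, altConv_succ_sq_left, altConv_succ_sq_right, ← altConv_add]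
    refine altConv_congr fun i j h => ?_
    rw [← h]; ring
  rw [altConv_mul, altConv_mul] at hd
  rw [altConv_mul, hcube, altConv_add, altConv_mul, altConv_mul, hs2] at hs3
  have hN : ((N : ℝ) + 1) ^ 2 ≠ 0 := by positivity
  rw [mul_left_cancel₀ hN hd] at hs3
  linear_combination (-2) * hs3

theorem factorial_mul_altConv (m : ℕ) :
    m.factorial * altConv m (fun _ _ => 1) = ∑ p ∈ antidiagonal m,
      arcsineMoment p.1 * arcsineMoment p.2 * ((-1) ^ p.1 * (m.choose p.1 : ℝ)) := by
  unfold altConv arcsineCoeff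
  rw [mul_sum]
  refine sum_congr rfl fun p hp => ?_
  obtain rfl := HasAntidiagonal.mem_antidiagonal.1 hp
  rw [Nat.cast_add_choose]
  field_simp

theorem sum_arcsineMoment_mul_alternating_choose (k : ℕ) :
    ∑ p ∈ antidiagonal (2 * k), arcsineMoment p.1 * arcsineMoment p.2 *
      ((-1) ^ p.1 * ((2 * k).choose p.1 : ℝ)) = burnsideEigenvalue k := by
  rw [← factorial_mul_altConv, burnsideEigenvalue_eq]
  induction k with
  | zero => simp [altConv, arcsineCoeff, arcsineMoment_zero]
  | succ k ih =>
    have h1 := altConv_add_two (2 * k)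
    have h2 := arcsineMoment_succ k
    have h3 : arcsineMoment (k + 1) = (k + 1 / 2) / (k + 1) * arcsineMoment k := by
      field_simp
      linear_combination 2 * h2
    rw [h3, mul_pow, ← ih, show 2 * (k + 1) = 2 * k + 2 by ring, Nat.factorial_succ,
      Nat.factorial_succ]
    have h4 : altConv (2 * k + 2) (fun _ _ => 1) =
        (2 * k + 1) / (2 * k + 2) ^ 3 * altConv (2 * k) (fun _ _ => 1) := by
      push_cast at h1
      field_simp
      linear_combination h1
    rw [h4]
    push_cast
    field_simp
    ring

/-! ### The arcsine chain and its eigenvector -/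

/-- The mean of `h (I + J)` for independent discrete arcsine variables `I` on `{0, …, a}` and `J`
on `{0, …, b}`. -/
noncomputable def arcsineAvg (a b : ℕ) (h : ℕ → ℝ) : ℝ :=
  ∑ p ∈ antidiagonal a, ∑ q ∈ antidiagonal b,
    arcsineMoment p.1 * arcsineMoment p.2 * (arcsineMoment q.1 * arcsineMoment q.2) *
      h (p.1 + q.1)

theorem arcsineAvg_sum_mul {ι : Type*} (a b : ℕ) (D : Finset ι) (t : ι → ℝ) (h : ι → ℕ → ℝ) :
    arcsineAvg a b (fun j => ∑ d ∈ D, t d * h d j) = ∑ d ∈ D, t d * arcsineAvg a b (h d) := by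
  unfold arcsineAvg
  simp only [mul_sum]
  rw [sum_comm' (t' := antidiagonal a) (s' := fun _ => D) (by simp [and_comm])]
  refine sum_congr rfl fun p _ => ?_
  rw [sum_comm]
  refine sum_congr rfl fun q _ => sum_congr rfl fun d _ => by ring

theorem arcsineAvg_congr {a b : ℕ} {h g : ℕ → ℝ} (H : ∀ j ≤ a + b, h j = g j) :
    arcsineAvg a b h = arcsineAvg a b g := by
  refine sum_congr rfl fun p hp => sum_congr rfl fun q hq => ?_
  rw [HasAntidiagonal.mem_antidiagonal] at hp hq
  rw [H _ (by omega)]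

theorem arcsineAvg_choose (a b d : ℕ) :
    arcsineAvg a b (fun j => (j.choose d : ℝ)) =
      ∑ r ∈ antidiagonal d, (a.choose r.1 * arcsineMoment r.1) *
        (b.choose r.2 * arcsineMoment r.2) := by
  simp only [← sum_arcsineMoment_mul_choose, sum_mul_sum]
  unfold arcsineAvg
  rw [sum_comm (s := antidiagonal d)]
  refine sum_congr rfl fun p _ => ?_
  rw [sum_comm (s := antidiagonal d)]
  refine sum_congr rfl fun q _ => ?_
  simp only [Nat.add_choose_eq]
  push_cast
  rw [mul_sum]
  exact sum_congr rfl fun r _ => by ring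

/-- Symmetry of the chain on {0, …, m}: the weight is a product over the entries of a 2 × 2 table
whose row sums give the old state and column sums the new one, and transposing the table preserves
it. -/
theorem sum_mul_arcsineAvg_comm (m : ℕ) (g h : ℕ → ℝ) :
    ∑ s ∈ antidiagonal m, g s.1 * arcsineAvg s.1 s.2 h =
      ∑ s ∈ antidiagonal m, h s.1 * arcsineAvg s.1 s.2 g := by
  unfold arcsineAvg
  simp only [mul_sum]
  rw [sum_sigma', sum_sigma', sum_sigma', sum_sigma']
  refine sum_nbij'
    (fun z => ⟨⟨(z.1.2.1 + z.2.1, z.1.2.2 + z.2.2), (z.1.2.1, z.2.1)⟩, (z.1.2.2, z.2.2)⟩)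
    (fun z => ⟨⟨(z.1.2.1 + z.2.1, z.1.2.2 + z.2.2), (z.1.2.1, z.2.1)⟩, (z.1.2.2, z.2.2)⟩)
    ?_ ?_ ?_ ?_ ?_
  · rintro ⟨⟨⟨s, t⟩, ⟨i, i'⟩⟩, ⟨j, j'⟩⟩ hz
    simp only [mem_sigma, HasAntidiagonal.mem_antidiagonal, and_true] at hz ⊢
    omega
  · rintro ⟨⟨⟨s, t⟩, ⟨i, i'⟩⟩, ⟨j, j'⟩⟩ hz
    simp only [mem_sigma, HasAntidiagonal.mem_antidiagonal, and_true] at hz ⊢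
    omega
  · rintro ⟨⟨⟨s, t⟩, ⟨i, i'⟩⟩, ⟨j, j'⟩⟩ hz
    simp only [mem_sigma, HasAntidiagonal.mem_antidiagonal] at hz ⊢
    obtain ⟨⟨_, rfl⟩, rfl⟩ := hz
    rfl
  · rintro ⟨⟨⟨s, t⟩, ⟨i, i'⟩⟩, ⟨j, j'⟩⟩ hz
    simp only [mem_sigma, HasAntidiagonal.mem_antidiagonal] at hz ⊢
    obtain ⟨⟨_, rfl⟩, rfl⟩ := hz
    rfl
  · rintro ⟨⟨⟨s, t⟩, ⟨i, i'⟩⟩, ⟨j, j'⟩⟩ hz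
    simp only [mem_sigma, HasAntidiagonal.mem_antidiagonal] at hz ⊢
    obtain ⟨⟨_, rfl⟩, rfl⟩ := hz
    ring

/-- An m-th finite difference kills a polynomial of degree e + e' < m. Pascal's rule trades one unit
of m for one difference, which lowers e or e' by one. -/
theorem sum_alternating_choose_mul_choose_mul_choose {m e e' : ℕ} (h : e + e' < m) :
    ∑ s ∈ antidiagonal m, (-1 : ℝ) ^ s.1 * (m.choose s.1 : ℝ) *
      ((s.1.choose e : ℝ) * (s.2.choose e' : ℝ)) = 0 := by
  induction m generalizing e e' with
  | zero => omega
  | succ m ih =>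
    have hP : ∀ (g : ℕ → ℕ → ℝ), ∑ s ∈ antidiagonal (m + 1), (-1 : ℝ) ^ s.1 *
        ((m + 1).choose s.1 : ℝ) * g s.1 s.2 =
        ∑ s ∈ antidiagonal m, (-1 : ℝ) ^ s.1 * (m.choose s.1 : ℝ) *
          (g s.1 (s.2 + 1) - g (s.1 + 1) s.2) := by
      intro g
      have := Finset.sum_antidiagonal_choose_succ_mul (fun i j => (-1 : ℝ) ^ i * g i j) m
      rw [sum_congr rfl fun s _ => show (-1 : ℝ) ^ s.1 * ((m + 1).choose s.1 : ℝ) * g s.1 s.2 =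
        ((m + 1).choose s.1 : ℝ) * ((-1 : ℝ) ^ s.1 * g s.1 s.2) by ring, this,
        ← sum_add_distrib]
      refine sum_congr rfl fun s hs => ?_
      rw [Nat.choose_symm_of_eq_add (HasAntidiagonal.mem_antidiagonal.1 hs).symm, pow_succ]
      ring
    rw [hP fun i j => (i.choose e : ℝ) * (j.choose e' : ℝ)]
    have hdiff : ∀ i j : ℕ, ((i.choose e : ℝ) * ((j + 1).choose e' : ℝ) -
        ((i + 1).choose e : ℝ) * (j.choose e' : ℝ)) =
        (if e' = 0 then 0 else (i.choose e : ℝ) * (j.choose (e' - 1) : ℝ)) -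
        (if e = 0 then 0 else (i.choose (e - 1) : ℝ) * (j.choose e' : ℝ)) := by
      intro i j
      cases e <;> cases e' <;> (simp [Nat.choose_succ_succ]; try ring)
    simp only [hdiff, mul_sub, sum_sub_distrib]
    have h1 : ∑ s ∈ antidiagonal m, (-1 : ℝ) ^ s.1 * (m.choose s.1 : ℝ) *
        (if e' = 0 then 0 else (s.1.choose e : ℝ) * (s.2.choose (e' - 1) : ℝ)) = 0 := by
      split_ifs with h0
      · simp
      · exact ih (by omega)
    have h2 : ∑ s ∈ antidiagonal m, (-1 : ℝ) ^ s.1 * (m.choose s.1 : ℝ) *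
        (if e = 0 then 0 else (s.1.choose (e - 1) : ℝ) * (s.2.choose e' : ℝ)) = 0 := by
      split_ifs with h0
      · simp
      · exact ih (by omega)
    rw [h1, h2, sub_zero]

/-- The conditions are triangular: testing against d = j leaves only indices ≥ j, so the values
vanish by descent from m. -/
theorem eq_zero_of_sum_mul_choose_eq_zero {m : ℕ} {w : ℕ → ℝ} (hm : w m = 0)
    (h : ∀ d < m, ∑ s ∈ antidiagonal m, w s.1 * (s.1.choose d : ℝ) = 0) {j : ℕ} (hj : j ≤ m) :
    w j = 0 := by
  induction hr : m - j using Nat.strong_induction_on generalizing j with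
  | _ r ih =>
    rcases hj.eq_or_lt with rfl | hlt
    · exact hm
    · have hs := h j hlt
      rw [sum_eq_single (j, m - j)] at hs
      · simpa using hs
      · rintro ⟨i, i'⟩ hi hne
        rw [HasAntidiagonal.mem_antidiagonal] at hi
        simp only at hi ⊢
        rcases lt_trichotomy i j with hij | rfl | hij
        · simp [Nat.choose_eq_zero_of_lt hij]
        · exact absurd (by rw [Prod.mk.injEq]; omega) hne
        · rw [ih (m - i) (by omega) (by omega) rfl, zero_mul]
      · intro hn
        exact absurd (HasAntidiagonal.mem_antidiagonal.2 (by omega)) hn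

/-- For even `m`, `j ↦ (-1)^j C(m, j)` is an eigenvector of the one-set arcsine chain. -/
theorem arcsineAvg_alternating_choose {a b k : ℕ} (hab : a + b = 2 * k) :
    arcsineAvg a b (fun j => (-1) ^ j * ((2 * k).choose j : ℝ)) =
      burnsideEigenvalue k * ((-1) ^ a * ((2 * k).choose a : ℝ)) := by
  set v : ℕ → ℝ := fun j => (-1) ^ j * ((2 * k).choose j : ℝ) with hv
  set w : ℕ → ℝ := fun i => arcsineAvg i (2 * k - i) v - burnsideEigenvalue k * v i with hw
  -- `w` is the defect in the eigenvector equation. It vanishes at 2k by the evaluation of β_k, and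
  -- it is orthogonal to polynomials of degree < 2k because `v` is and the symmetric chain does not
  -- raise degrees.
  have h0 : w a = 0 := by
    refine eq_zero_of_sum_mul_choose_eq_zero (m := 2 * k) ?_ (fun d hd => ?_) (by omega)
    · have : arcsineAvg (2 * k) 0 v = burnsideEigenvalue k := by
        rw [← sum_arcsineMoment_mul_alternating_choose]
        simp [arcsineAvg, hv, arcsineMoment_zero]
      have hv1 : v (2 * k) = 1 := by simp [hv]
      simp only [hw, Nat.sub_self]
      rw [this, hv1, mul_one, sub_self]
    · have h1 : ∑ s ∈ antidiagonal (2 * k), w s.1 * (s.1.choose d : ℝ) =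
          ∑ s ∈ antidiagonal (2 * k), (s.1.choose d : ℝ) * arcsineAvg s.1 s.2 v -
            burnsideEigenvalue k * ∑ s ∈ antidiagonal (2 * k), (-1 : ℝ) ^ s.1 *
              ((2 * k).choose s.1 : ℝ) * ((s.1.choose d : ℝ) * (s.2.choose 0 : ℝ)) := by
        rw [mul_sum, ← sum_sub_distrib]
        refine sum_congr rfl fun s hs => ?_
        have : 2 * k - s.1 = s.2 := by have := HasAntidiagonal.mem_antidiagonal.1 hs; omega
        simp only [hw, this, hv, Nat.choose_zero_right]
        push_cast
        ring
      rw [h1, sum_alternating_choose_mul_choose_mul_choose (by omega), mul_zero, sub_zero,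
        sum_mul_arcsineAvg_comm _ (fun i => (i.choose d : ℝ))]
      simp only [arcsineAvg_choose, mul_sum]
      rw [sum_comm]
      refine sum_eq_zero fun r hr => ?_
      have := sum_alternating_choose_mul_choose_mul_choose (m := 2 * k) (e := r.1) (e' := r.2)
        (by have := HasAntidiagonal.mem_antidiagonal.1 hr; omega)
      rw [← mul_zero (arcsineMoment r.1 * arcsineMoment r.2), ← this, mul_sum]
      exact sum_congr rfl fun s _ => by simp only [hv]; ring
  have : 2 * k - a = b := by omega
  simp only [hw, this] at h0
  linarith

/-! ### Random colour-preserving permutations, one point at a time -/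

theorem apply_swap_eq_of_eq {α β : Type*} [DecidableEq α] {x : α → β} {t u : α} (h : x u = x t) (i : α) :
    x (Equiv.swap t u i) = x i := by
  by_cases h1 : i = t
  · subst h1; simpa using h
  · by_cases h2 : i = u
    · subst h2; simpa using h.symm
    · rw [Equiv.swap_apply_of_ne_of_ne h1 h2]

section Permutations

variable {α κ : Type*} [Fintype α] [DecidableEq α] [DecidableEq κ]

/-- The permutations that preserve the colouring `x` and fix every point outside `R`. -/
def colorPerms (x : α → κ) (R : Finset α) : Finset (Equiv.Perm α) :=
  univ.filter fun s => (∀ i, x (s i) = x i) ∧ ∀ i ∉ R, s i = i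

/-- The binary colourings that are invariant under `s` and equal to `1` on `T`. -/
def invariantOnes (s : Equiv.Perm α) (T : Finset α) : Finset (α → Fin 2) :=
  univ.filter fun y => (∀ i, y (s i) = y i) ∧ ∀ i ∈ T, y i = 1

/-- The probability that a uniform `s`-invariant binary colouring equals `1` on `T`. -/
noncomputable def onesProb (s : Equiv.Perm α) (T : Finset α) : ℝ :=
  ((invariantOnes s T).card : ℝ) / ((invariantOnes s ∅).card : ℝ)

theorem mem_colorPerms {x : α → κ} {R : Finset α} {s : Equiv.Perm α} :
    s ∈ colorPerms x R ↔ (∀ i, x (s i) = x i) ∧ ∀ i ∉ R, s i = i := by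
  simp [colorPerms]

theorem mem_invariantOnes {s : Equiv.Perm α} {T : Finset α} {y : α → Fin 2} :
    y ∈ invariantOnes s T ↔ (∀ i, y (s i) = y i) ∧ ∀ i ∈ T, y i = 1 := by
  simp [invariantOnes]

theorem colorPerms_card_pos (x : α → κ) (R : Finset α) : 0 < (colorPerms x R).card :=
  card_pos.2 ⟨1, by simp [mem_colorPerms]⟩

theorem invariantOnes_card_pos (s : Equiv.Perm α) (T : Finset α) :
    0 < (invariantOnes s T).card :=
  card_pos.2 ⟨fun _ => 1, by simp [mem_invariantOnes]⟩

/-- Coset decomposition over the stabilizer of `t`: `s` is determined by u = `s t` and by `swap t u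
* s`, which fixes `t`. -/
theorem sum_colorPerms {M : Type*} [AddCommMonoid M] (x : α → κ) {R : Finset α} {t : α}
    (ht : t ∈ R) (φ : Equiv.Perm α → M) :
    ∑ s ∈ colorPerms x R, φ s =
      ∑ f ∈ colorPerms x (R.erase t), ∑ u ∈ R with x u = x t, φ (Equiv.swap t u * f) := by
  rw [← sum_product']
  refine sum_nbij' (fun s => (Equiv.swap t (s t) * s, s t)) (fun z => Equiv.swap t z.2 * z.1)
    ?_ ?_ ?_ ?_ ?_
  · intro s hs
    obtain ⟨h1, h2⟩ := mem_colorPerms.1 hs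
    have hst : s t ∈ R := by
      by_contra hn
      have := s.injective (h2 _ hn)
      exact hn (this.symm ▸ ht)
    simp only [mem_product, mem_colorPerms, mem_filter, Equiv.Perm.mul_apply, mem_erase]
    refine ⟨⟨fun i => ?_, fun i hi => ?_⟩, hst, h1 t⟩
    · rw [apply_swap_eq_of_eq (h1 t), h1]
    · by_cases hit : i = t
      · subst hit; simp
      · have hiR : i ∉ R := fun h => hi ⟨hit, h⟩
        rw [h2 i hiR, Equiv.swap_apply_of_ne_of_ne hit]
        rintro rfl
        exact hiR hst
  · rintro ⟨f, u⟩ hz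
    simp only [mem_product, mem_colorPerms, mem_filter, mem_erase] at hz
    obtain ⟨⟨h1, h2⟩, hu, hut⟩ := hz
    simp only [mem_colorPerms, Equiv.Perm.mul_apply]
    refine ⟨fun i => by rw [apply_swap_eq_of_eq hut, h1], fun i hi => ?_⟩
    rw [h2 i fun h => hi h.2, Equiv.swap_apply_of_ne_of_ne]
    · rintro rfl; exact hi ht
    · rintro rfl; exact hi hu
  · intro s _
    simp [← mul_assoc]
  · rintro ⟨f, u⟩ hz
    simp only [mem_product, mem_colorPerms, mem_filter, mem_erase] at hz
    have : f t = t := hz.1.2 t (by simp)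
    simp [this, ← mul_assoc]
  · intro s _
    simp [← mul_assoc]

theorem card_colorPerms (x : α → κ) {R : Finset α} {t : α} (ht : t ∈ R) :
    (colorPerms x R).card =
      (R.filter fun u => x u = x t).card * (colorPerms x (R.erase t)).card := by
  rw [card_eq_sum_ones, sum_colorPerms x ht]
  simp [mul_comm]

/-- Multiplying by the swap inserts the fixed point `t` into the cycle of `u`, so the only new
constraint is that the two colours agree. -/
theorem invariantOnes_swap_mul {f : Equiv.Perm α} {t u : α} (hf : f t = t) (T : Finset α) :
    invariantOnes (Equiv.swap t u * f) T = (invariantOnes f T).filter fun y => y u = y t := by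
  ext y
  simp only [mem_filter, mem_invariantOnes, Equiv.Perm.mul_apply]
  constructor
  · rintro ⟨h1, h2⟩
    have hut : y u = y t := by simpa [hf] using h1 t
    refine ⟨⟨fun i => ?_, h2⟩, hut⟩
    rw [← h1 i, apply_swap_eq_of_eq hut]
  · rintro ⟨⟨h1, h2⟩, hut⟩
    exact ⟨fun i => by rw [apply_swap_eq_of_eq hut, h1], h2⟩

theorem card_invariantOnes_swap_mul {f : Equiv.Perm α} {t u : α} (hf : f t = t) (hut : u ≠ t)
    {T : Finset α} (ht : t ∉ T) :
    (invariantOnes f T).card = 2 * (invariantOnes (Equiv.swap t u * f) T).card := by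
  have hfin : ∀ a b : Fin 2, (a = b + 1 ↔ ¬ a = b) := by decide
  have hfin' : ∀ a : Fin 2, a + 1 + 1 = a := by decide
  -- As `t` is fixed by `f` and outside `T`, its colour is free; flipping it exchanges the
  -- colourings with `y u = y t` and the others.
  have hmem : ∀ y ∈ invariantOnes f T, Function.update y t (y t + 1) ∈ invariantOnes f T := by
    intro y hy
    obtain ⟨h1, h2⟩ := mem_invariantOnes.1 hy
    refine mem_invariantOnes.2 ⟨fun i => ?_, fun i hi => ?_⟩
    · by_cases hit : i = t
      · subst hit; rw [hf]
      · have : f i ≠ t := fun h => hit (f.injective (h.trans hf.symm))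
        rw [Function.update_of_ne this, Function.update_of_ne hit, h1]
    · rw [Function.update_of_ne (by rintro rfl; exact ht hi), h2 i hi]
  rw [invariantOnes_swap_mul hf, ← card_filter_add_card_filter_not (s := invariantOnes f T)
    (fun y => y u = y t), two_mul, add_right_inj]
  refine card_nbij' (fun y => Function.update y t (y t + 1))
    (fun y => Function.update y t (y t + 1)) ?_ ?_ ?_ ?_
  · intro y hy
    simp only [coe_filter, Set.mem_ofPred_eq] at hy ⊢
    refine ⟨hmem y hy.1, ?_⟩
    rw [Function.update_of_ne hut, Function.update_self, hfin]
    exact hy.2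
  · intro y hy
    simp only [coe_filter, Set.mem_ofPred_eq] at hy ⊢
    refine ⟨hmem y hy.1, ?_⟩
    rw [Function.update_of_ne hut, Function.update_self, ← hfin, hy.2, hfin']
  · intro y _
    simp [hfin']
  · intro y _
    simp [hfin']

theorem onesProb_swap_mul_of_notMem {f : Equiv.Perm α} {t u : α} (hf : f t = t) {T : Finset α}
    (ht : t ∉ T) : onesProb (Equiv.swap t u * f) T = onesProb f T := by
  by_cases hut : u = t
  · subst hut; rw [Equiv.swap_self]; rfl
  · unfold onesProb
    rw [card_invariantOnes_swap_mul hf hut ht,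
      card_invariantOnes_swap_mul hf hut (notMem_empty t)]
    push_cast
    rw [mul_div_mul_left _ _ two_ne_zero]

theorem onesProb_swap_mul_of_mem {f : Equiv.Perm α} {t u : α} (hf : f t = t) {T : Finset α}
    (ht : t ∈ T) (hu : u ∈ T) (hut : u ≠ t) :
    onesProb (Equiv.swap t u * f) T = 2 * onesProb f T := by
  have h : invariantOnes (Equiv.swap t u * f) T = invariantOnes f T := by
    rw [invariantOnes_swap_mul hf, filter_eq_self]
    intro y hy
    have := (mem_invariantOnes.1 hy).2
    rw [this t ht, this u hu]
  unfold onesProb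
  rw [h, card_invariantOnes_swap_mul hf hut (notMem_empty t)]
  have : ((invariantOnes (Equiv.swap t u * f) ∅).card : ℝ) ≠ 0 := by
    exact_mod_cast (invariantOnes_card_pos _ _).ne'
  push_cast
  field_simp

theorem onesProb_one (T : Finset α) : onesProb (1 : Equiv.Perm α) T = 1 / 2 ^ T.card := by
  have h : ∀ U : Finset α, ((invariantOnes (1 : Equiv.Perm α) U).card : ℝ) * 2 ^ U.card =
      2 ^ Fintype.card α := by
    intro U
    have : invariantOnes (1 : Equiv.Perm α) U =
        Fintype.piFinset fun i => if i ∈ U then {1} else univ := by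
      ext y
      simp only [mem_invariantOnes, Equiv.Perm.one_apply, implies_true, true_and,
        Fintype.mem_piFinset]
      refine forall_congr' fun i => ?_
      split_ifs with hi <;> simp [hi]
    rw [this, Fintype.card_piFinset]
    simp only [apply_ite Finset.card, card_singleton, card_univ, Fintype.card_fin]
    rw [prod_ite]
    simp only [prod_const_one, one_mul, prod_const, filter_not, filter_mem_eq_inter, univ_inter]
    push_cast
    rw [← pow_add, card_sdiff_add_card_eq_card (subset_univ U), card_univ]
  unfold onesProb
  have h0 := h ∅
  rw [card_empty, pow_zero, mul_one] at h0
  rw [h0, ← h T]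
  have : ((invariantOnes (1 : Equiv.Perm α) T).card : ℝ) ≠ 0 := by
    exact_mod_cast (invariantOnes_card_pos _ _).ne'
  field_simp

/-- The mean of `onesProb s T` over the permutations `s` in `colorPerms x R`. -/
noncomputable def meanOnesProb (x : α → κ) (R T : Finset α) : ℝ :=
  (∑ s ∈ colorPerms x R, onesProb s T) / ((colorPerms x R).card : ℝ)

theorem apply_eq_self_of_mem_colorPerms_erase {x : α → κ} {R : Finset α} {t : α}
    {f : Equiv.Perm α} (hf : f ∈ colorPerms x (R.erase t)) : f t = t :=
  (mem_colorPerms.1 hf).2 t (by simp)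

theorem meanOnesProb_erase_of_notMem (x : α → κ) {R T : Finset α} {t : α} (ht : t ∈ R)
    (htT : t ∉ T) : meanOnesProb x R T = meanOnesProb x (R.erase t) T := by
  unfold meanOnesProb
  rw [sum_colorPerms x ht, card_colorPerms x ht]
  rw [sum_congr rfl fun f hf => sum_congr rfl fun u _ =>
    onesProb_swap_mul_of_notMem (apply_eq_self_of_mem_colorPerms_erase hf) htT]
  have : ((R.filter fun u => x u = x t).card : ℝ) ≠ 0 := by
    exact_mod_cast (card_pos.2 ⟨t, by simp [ht]⟩).ne'
  simp only [sum_const, nsmul_eq_mul, ← mul_sum]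
  push_cast
  rw [mul_div_mul_left _ _ this]

/-- Let a be the number of points of `R` with the colour of `t`. Inserting `t` as its own cycle
keeps the probability; each of the other a - 1 insertions merges two cycles meeting `T` and doubles
it. The total is 1 + 2(a - 1) = 2a - 1. -/
theorem meanOnesProb_erase_of_subset (x : α → κ) {R T : Finset α} {t : α} (ht : t ∈ R)
    (hRT : R ⊆ T) :
    ((R.filter fun u => x u = x t).card : ℝ) * meanOnesProb x R T =
      (2 * ((R.filter fun u => x u = x t).card : ℝ) - 1) * meanOnesProb x (R.erase t) T := by
  have htm : t ∈ R.filter fun u => x u = x t := by simp [ht]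
  have hsum : ∀ f ∈ colorPerms x (R.erase t),
      ∑ u ∈ R with x u = x t, onesProb (Equiv.swap t u * f) T =
        (2 * ((R.filter fun u => x u = x t).card : ℝ) - 1) * onesProb f T := by
    intro f hf
    have hft := apply_eq_self_of_mem_colorPerms_erase hf
    rw [← add_sum_erase _ _ htm, Equiv.swap_self, sum_congr rfl fun u hu =>
      onesProb_swap_mul_of_mem (u := u) hft (hRT ht)
        (hRT (mem_filter.1 (mem_of_mem_erase hu)).1) (ne_of_mem_erase hu)]
    rw [sum_const, nsmul_eq_mul, card_erase_of_mem htm,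
      Nat.cast_sub (card_pos.2 ⟨t, htm⟩)]
    change onesProb (1 * f) T + _ = _
    rw [one_mul]
    push_cast
    ring
  unfold meanOnesProb
  rw [sum_colorPerms x ht, card_colorPerms x ht, sum_congr rfl hsum, ← mul_sum]
  have h1 : ((R.filter fun u => x u = x t).card : ℝ) ≠ 0 := by
    exact_mod_cast (card_pos.2 ⟨t, htm⟩).ne'
  have h2 : ((colorPerms x (R.erase t)).card : ℝ) ≠ 0 := by
    exact_mod_cast (colorPerms_card_pos _ _).ne'
  push_cast
  field_simp

theorem meanOnesProb_empty (x : α → κ) (T : Finset α) :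
    meanOnesProb x ∅ T = 1 / 2 ^ T.card := by
  have : colorPerms x ∅ = {1} := by
    ext s
    simp only [mem_colorPerms, notMem_empty, not_false_eq_true, forall_const, mem_singleton]
    constructor
    · rintro ⟨_, h⟩
      exact Equiv.ext h
    · rintro rfl
      simp
  simp [meanOnesProb, this, onesProb_one]

theorem meanOnesProb_of_subset [Fintype κ] (x : α → κ) {R T : Finset α} (hRT : R ⊆ T) :
    meanOnesProb x R T * 2 ^ T.card =
      ∏ v, 2 ^ (R.filter fun u => x u = v).card *
        arcsineMoment (R.filter fun u => x u = v).card := by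
  induction hr : R.card generalizing R with
  | zero =>
    obtain rfl := card_eq_zero.1 hr
    simp [meanOnesProb_empty, arcsineMoment_zero]
  | succ r ih =>
    obtain ⟨t, ht⟩ := card_pos.1 (show 0 < R.card by omega)
    have hE := ih ((erase_subset t R).trans hRT) (by rw [card_erase_of_mem ht, hr]; rfl)
    have h := meanOnesProb_erase_of_subset x ht hRT
    have htm : t ∈ R.filter fun u => x u = x t := by simp [ht]
    rw [← mul_prod_erase _ _ (mem_univ (x t))] at hE ⊢
    have hne : ∀ v ∈ univ.erase (x t),
        (R.erase t).filter (fun u => x u = v) = R.filter fun u => x u = v := by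
      intro v hv
      rw [filter_erase, erase_eq_of_notMem]
      simp only [mem_filter, not_and]
      exact fun _ h => ne_of_mem_erase hv h.symm
    rw [prod_congr rfl fun v hv => by rw [hne v hv]] at hE
    obtain ⟨m, hm⟩ : ∃ m, (R.filter fun u => x u = x t).card = m + 1 :=
      ⟨_, (Nat.succ_pred_eq_of_pos (card_pos.2 ⟨t, htm⟩)).symm⟩
    rw [filter_erase, card_erase_of_mem htm, hm, Nat.add_sub_cancel] at hE
    rw [hm] at h ⊢
    set Q := ∏ v ∈ univ.erase (x t), (2 ^ (R.filter fun u => x u = v).card *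
        arcsineMoment (R.filter fun u => x u = v).card : ℝ)
    have hc := arcsineMoment_succ m
    push_cast at h
    have hm0 : (m : ℝ) + 1 ≠ 0 := by positivity
    apply mul_left_cancel₀ hm0
    rw [pow_succ]
    linear_combination 2 ^ T.card * h + (2 * ((m : ℝ) + 1) - 1) * hE - 2 ^ m * 2 * Q * hc

/-- Points outside `T` can be deleted without changing the mean, which leaves R = T; the powers of 2
then cancel. -/
theorem meanOnesProb_univ [Fintype κ] (x : α → κ) (T : Finset α) :
    meanOnesProb x univ T = ∏ v, arcsineMoment (T.filter fun u => x u = v).card := by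
  have hred : ∀ R : Finset α, T ⊆ R → meanOnesProb x R T = meanOnesProb x T T := by
    intro R hR
    induction hr : (R \ T).card generalizing R with
    | zero => rw [hR.antisymm (sdiff_eq_empty_iff_subset.1 (card_eq_zero.1 hr))]
    | succ r ih =>
      obtain ⟨t, ht⟩ := card_pos.1 (show 0 < (R \ T).card by omega)
      obtain ⟨htR, htT⟩ := mem_sdiff.1 ht
      rw [meanOnesProb_erase_of_notMem x htR htT]
      refine ih _ (subset_erase.2 ⟨hR, htT⟩) ?_
      rw [erase_sdiff_comm, card_erase_of_mem ht, hr]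
      rfl
  rw [hred _ (subset_univ T)]
  have h := meanOnesProb_of_subset x (Subset.refl T)
  rw [prod_mul_distrib, prod_pow_eq_pow_sum,
    ← card_eq_sum_card_fiberwise (f := x) (t := univ) (fun _ _ => by simp), mul_comm] at h
  exact mul_left_cancel₀ (by positivity) h

end Permutations

/-! ### Action of the Burnside matrix on functions of |x_S| -/

theorem binaryBurnside_mulVec (n : ℕ) (f : (Fin n → Fin 2) → ℝ) (x : Fin n → Fin 2) :
    (binaryBurnside n).mulVec f x =
      (∑ s ∈ colorPerms x univ,
        (∑ y ∈ invariantOnes s ∅, f y) / ((invariantOnes s ∅).card : ℝ)) /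
        ((colorPerms x univ).card : ℝ) := by
  classical
  let _ : MulAction (Equiv.Perm (Fin n)) (Fin n → Fin 2) := arrowAction
  have hsmul : ∀ (s : Equiv.Perm (Fin n)) (y : Fin n → Fin 2),
      s • y = y ↔ ∀ i, y (s i) = y i := by
    intro s y
    constructor
    · intro h i
      have h' : y (s⁻¹ (s i)) = y (s i) := congrFun h (s i)
      simpa using h'.symm
    · intro h
      funext i
      change y (s⁻¹ i) = y i
      rw [← h (s⁻¹ i)]
      simp
  have hstab : Nat.card (MulAction.stabilizer (Equiv.Perm (Fin n)) x) =
      (colorPerms x univ).card := by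
    refine Nat.subtype_card _ fun s => ?_
    rw [MulAction.mem_stabilizer_iff, hsmul]
    simp [mem_colorPerms]
  have hfix : ∀ s : Equiv.Perm (Fin n),
      Nat.card (MulAction.fixedBy (Fin n → Fin 2) s) = (invariantOnes s ∅).card := by
    intro s
    refine Nat.subtype_card _ fun y => ?_
    rw [MulAction.mem_fixedBy, hsmul]
    simp [mem_invariantOnes]
  change ∑ y, burnsideMatrix (Equiv.Perm (Fin n)) (Fin n → Fin 2) x y * f y = _
  have hentry : ∀ y, burnsideMatrix (Equiv.Perm (Fin n)) (Fin n → Fin 2) x y * f y =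
      (∑ s ∈ colorPerms x univ, if y ∈ invariantOnes s ∅ then
        f y / ((invariantOnes s ∅).card : ℝ) else 0) / ((colorPerms x univ).card : ℝ) := by
    intro y
    unfold burnsideMatrix
    rw [Matrix.of_apply, hstab, ← sum_filter, mul_assoc, sum_mul, one_div, inv_mul_eq_div]
    congr 1
    refine sum_congr ?_ fun s _ => ?_
    · ext s
      simp [mem_colorPerms, mem_invariantOnes, hsmul]
    · rw [hfix]; ring
  simp only [hentry]
  rw [← sum_div, sum_comm]
  congr 1
  refine sum_congr rfl fun s _ => ?_
  rw [← sum_filter, sum_div]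
  simp

theorem binaryBurnside_mulVec_ones (n : ℕ) (T : Finset (Fin n)) (x : Fin n → Fin 2) :
    (binaryBurnside n).mulVec (fun y => if ∀ i ∈ T, y i = 1 then 1 else 0) x =
      arcsineMoment (T.filter fun i => x i = 0).card *
        arcsineMoment (T.filter fun i => x i = 1).card := by
  rw [← Fin.prod_univ_two (f := fun v => arcsineMoment (T.filter fun i => x i = v).card),
    ← meanOnesProb_univ, binaryBurnside_mulVec]
  unfold meanOnesProb onesProb
  congr 1
  refine sum_congr rfl fun s _ => ?_
  congr 1
  rw [sum_boole]
  congr 2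
  ext y
  simp [mem_invariantOnes]

/-- Binomial moments of |y_S| thus reduce to indicators of all-ones events. -/
theorem choose_onesIn {n : ℕ} (S : Finset (Fin n)) (d : ℕ) (y : Fin n → Fin 2) :
    ((onesIn y S).choose d : ℝ) =
      ∑ T ∈ S.powersetCard d, if ∀ i ∈ T, y i = 1 then 1 else 0 := by
  unfold onesIn
  rw [sum_boole, ← card_powersetCard]
  congr 2
  ext T
  simp only [mem_powersetCard, mem_filter, subset_iff]
  grind

/-- A weighted Vandermonde identity: split `T` into the points satisfying `p` and the rest. -/
theorem sum_powersetCard_filter {α M : Type*} [DecidableEq α] [CommSemiring M] (S : Finset α)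
    (p : α → Prop) [DecidablePred p] (d : ℕ) (φ ψ : ℕ → M) :
    ∑ T ∈ S.powersetCard d, φ (T.filter p).card * ψ (T.filter fun i => ¬ p i).card =
      ∑ r ∈ antidiagonal d, (((S.filter p).card.choose r.1 : M) * φ r.1) *
        (((S.filter fun i => ¬ p i).card.choose r.2 : M) * ψ r.2) := by
  have h : ∀ r ∈ antidiagonal d, (((S.filter p).card.choose r.1 : M) * φ r.1) *
        (((S.filter fun i => ¬ p i).card.choose r.2 : M) * ψ r.2) =
      ∑ z ∈ (S.filter p).powersetCard r.1 ×ˢ (S.filter fun i => ¬ p i).powersetCard r.2,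
        φ z.1.card * ψ z.2.card := by
    intro r _
    rw [sum_product, ← card_powersetCard, ← card_powersetCard, ← nsmul_eq_mul, ← nsmul_eq_mul,
      ← sum_const, ← sum_const, sum_mul_sum]
    refine sum_congr rfl fun a ha => sum_congr rfl fun b hb => ?_
    rw [(mem_powersetCard.1 ha).2, (mem_powersetCard.1 hb).2]
  rw [sum_congr rfl h, sum_sigma']
  refine sum_bij' (fun T _ => ⟨((T.filter p).card, (T.filter fun i => ¬ p i).card),
      (T.filter p, T.filter fun i => ¬ p i)⟩) (fun z _ => z.2.1 ∪ z.2.2) ?_ ?_ ?_ ?_ ?_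
  · intro T hT
    obtain ⟨hTS, hTd⟩ := mem_powersetCard.1 hT
    simp only [mem_sigma, HasAntidiagonal.mem_antidiagonal, mem_product, mem_powersetCard,
      and_true]
    exact ⟨by rw [card_filter_add_card_filter_not, hTd], filter_subset_filter _ hTS,
      filter_subset_filter _ hTS⟩
  · rintro ⟨⟨i, j⟩, ⟨A, B⟩⟩ hz
    simp only [mem_sigma, HasAntidiagonal.mem_antidiagonal, mem_product, mem_powersetCard] at hz ⊢
    obtain ⟨hij, ⟨hA, rfl⟩, hB, rfl⟩ := hz
    refine ⟨union_subset (hA.trans (filter_subset _ _)) (hB.trans (filter_subset _ _)), ?_⟩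
    rw [card_union_of_disjoint, hij]
    exact (disjoint_filter_filter_not S S p).mono hA hB
  · intro T _
    exact filter_union_filter_not_eq p T
  · rintro ⟨⟨i, j⟩, ⟨A, B⟩⟩ hz
    simp only [mem_sigma, HasAntidiagonal.mem_antidiagonal, mem_product, mem_powersetCard] at hz ⊢
    obtain ⟨hij, ⟨hA, rfl⟩, hB, rfl⟩ := hz
    have h1 : (A ∪ B).filter p = A := by
      ext i
      have := @hA i
      have := @hB i
      simp only [mem_filter, mem_union] at *
      tauto
    have h2 : ((A ∪ B).filter fun i => ¬ p i) = B := by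
      ext i
      have := @hA i
      have := @hB i
      simp only [mem_filter, mem_union] at *
      tauto
    rw [h1, h2]
  · intro T _
    rfl

theorem binaryBurnside_mulVec_choose_onesIn {n : ℕ} (S : Finset (Fin n)) (d : ℕ)
    (x : Fin n → Fin 2) :
    (binaryBurnside n).mulVec (fun y => ((onesIn y S).choose d : ℝ)) x =
      arcsineAvg (onesIn x S) (S.filter fun i => ¬ x i = 1).card
        (fun j => (j.choose d : ℝ)) := by
  have hzero : ∀ T : Finset (Fin n), (T.filter fun i => x i = 0) = T.filter fun i => ¬ x i = 1 :=
    fun T => filter_congr fun i _ => by omega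
  have hf : (fun y => ((onesIn y S).choose d : ℝ)) =
      ∑ T ∈ S.powersetCard d, fun y => if ∀ i ∈ T, y i = 1 then (1 : ℝ) else 0 := by
    funext y
    rw [choose_onesIn, Finset.sum_apply]
  rw [hf, Matrix.mulVec_sum, Finset.sum_apply, arcsineAvg_choose]
  simp only [binaryBurnside_mulVec_ones, hzero]
  unfold onesIn
  rw [← sum_powersetCard_filter S (fun i => x i = 1) d arcsineMoment arcsineMoment]
  exact sum_congr rfl fun T _ => mul_comm _ _

theorem onesIn_add_card_filter_not {n : ℕ} (x : Fin n → Fin 2) (S : Finset (Fin n)) :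
    onesIn x S + (S.filter fun i => ¬ x i = 1).card = S.card :=
  card_filter_add_card_filter_not _

/-- Newton's forward difference formula at 0; it makes agreement of binomial moments enough for all
functions. -/
theorem exists_eq_sum_mul_choose (m : ℕ) (h : ℕ → ℝ) :
    ∃ t : ℕ → ℝ, ∀ j ≤ m, h j = ∑ d ∈ range (m + 1), t d * (j.choose d : ℝ) := by
  refine ⟨fun d => (fwdDiff 1)^[d] h 0, fun j hj => ?_⟩
  have := shift_eq_sum_fwdDiff_iter 1 h j 0
  rw [zero_add, nsmul_eq_mul, mul_one, Nat.cast_id] at this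
  rw [this]
  simp only [nsmul_eq_mul]
  rw [sum_subset (range_subset_range.2 (Nat.succ_le_succ hj))]
  · exact sum_congr rfl fun d _ => mul_comm _ _
  · intro d _ hd
    rw [Nat.choose_eq_zero_of_lt (by simpa using hd), Nat.cast_zero, zero_mul]

/-- Restricted to functions of `|y_S|`, the binary Burnside process is the arcsine chain. -/
theorem binaryBurnside_mulVec_comp_onesIn {n : ℕ} (S : Finset (Fin n)) (h : ℕ → ℝ)
    (x : Fin n → Fin 2) :
    (binaryBurnside n).mulVec (fun y => h (onesIn y S)) x =
      arcsineAvg (onesIn x S) (S.filter fun i => ¬ x i = 1).card h := by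
  obtain ⟨t, ht⟩ := exists_eq_sum_mul_choose S.card h
  have hle : ∀ y : Fin n → Fin 2, onesIn y S ≤ S.card := fun y => card_filter_le _ _
  have hf : (fun y => h (onesIn y S)) =
      ∑ d ∈ range (S.card + 1), t d • fun y : Fin n → Fin 2 => ((onesIn y S).choose d : ℝ) := by
    funext y
    rw [ht _ (hle y), Finset.sum_apply]
    rfl
  rw [arcsineAvg_congr fun j hj => ht j (hj.trans (onesIn_add_card_filter_not x S).le),
    arcsineAvg_sum_mul, hf, Matrix.mulVec_sum, Finset.sum_apply]
  refine sum_congr rfl fun d _ => ?_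
  rw [Matrix.mulVec_smul, Pi.smul_apply, binaryBurnside_mulVec_choose_onesIn, smul_eq_mul]

/-! ### The eigenfunctions f_S and their independence -/

/-- `f_S(x) = (-1)^{|x_S|} C(|S|, |x_S|)`. -/
noncomputable def signedChoose {n : ℕ} (S : Finset (Fin n)) (x : Fin n → Fin 2) : ℝ :=
  (-1) ^ onesIn x S * (S.card.choose (onesIn x S) : ℝ)

theorem binaryBurnside_mulVec_signedChoose {n k : ℕ} {S : Finset (Fin n)}
    (hS : S.card = 2 * k) :
    (binaryBurnside n).mulVec (signedChoose S) = burnsideEigenvalue k • signedChoose S := by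
  funext x
  have := binaryBurnside_mulVec_comp_onesIn S (fun j => (-1) ^ j * (S.card.choose j : ℝ)) x
  unfold signedChoose
  rw [this, hS, arcsineAvg_alternating_choose ((onesIn_add_card_filter_not x S).trans hS)]
  rfl

/-- The `0/1`-indicator of a set of coordinates. -/
def indicatorTuple {n : ℕ} (A : Finset (Fin n)) (i : Fin n) : Fin 2 := if i ∈ A then 1 else 0

theorem onesIn_indicatorTuple {n : ℕ} (A S : Finset (Fin n)) :
    onesIn (indicatorTuple A) S = (S ∩ A).card := by
  unfold onesIn indicatorTuple
  congr 1
  ext i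
  simp

/-- f_S ignores a coordinate of `U` outside `S`, so toggling it cancels the alternating sum. For |S|
= |U| these sums therefore form a diagonal system separating the f_S. -/
theorem sum_powerset_signedChoose_of_not_subset {n : ℕ} {S U : Finset (Fin n)} (h : ¬ U ⊆ S) :
    ∑ A ∈ U.powerset, (-1) ^ A.card * signedChoose S (indicatorTuple A) = 0 := by
  obtain ⟨i, hiU, hiS⟩ := not_subset.1 h
  rw [← insert_erase hiU, sum_powerset_insert (notMem_erase i U), ← sum_add_distrib]
  refine sum_eq_zero fun A hA => ?_
  have hiA : i ∉ A := fun hi => notMem_erase i U (mem_powerset.1 hA hi)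
  unfold signedChoose
  rw [onesIn_indicatorTuple, onesIn_indicatorTuple, inter_insert_of_notMem hiS,
    card_insert_of_notMem hiA, pow_succ]
  ring

theorem sum_powerset_signedChoose_self_pos {n : ℕ} (S : Finset (Fin n)) :
    0 < ∑ A ∈ S.powerset, (-1) ^ A.card * signedChoose S (indicatorTuple A) := by
  refine sum_pos (fun A hA => ?_) ⟨∅, empty_mem_powerset S⟩
  unfold signedChoose
  rw [onesIn_indicatorTuple, inter_eq_right.2 (mem_powerset.1 hA), ← mul_assoc, ← mul_pow,
    neg_one_mul, neg_neg, one_pow, one_mul]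
  exact_mod_cast Nat.choose_pos (card_le_card (mem_powerset.1 hA))

theorem linearIndependent_signedChoose (n m : ℕ) :
    LinearIndependent ℝ
      (fun S : {S : Finset (Fin n) // S.card = m} => signedChoose S.1) := by
  rw [Fintype.linearIndependent_iff]
  intro g hg U
  have h : ∑ A ∈ U.1.powerset, (-1 : ℝ) ^ A.card *
      (∑ S : {S : Finset (Fin n) // S.card = m}, g S • signedChoose S.1) (indicatorTuple A) =
      ∑ S : {S : Finset (Fin n) // S.card = m}, g S *
        ∑ A ∈ U.1.powerset, (-1 : ℝ) ^ A.card * signedChoose S.1 (indicatorTuple A) := by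
    simp only [Finset.sum_apply, Pi.smul_apply, smul_eq_mul, mul_sum]
    rw [sum_comm]
    exact sum_congr rfl fun S _ => sum_congr rfl fun A _ => by ring
  rw [hg, sum_eq_single U] at h
  · simp only [Pi.zero_apply, mul_zero, sum_const_zero] at h
    exact (mul_eq_zero.1 h.symm).resolve_right (sum_powerset_signedChoose_self_pos U.1).ne'
  · intro S _ hSU
    rw [sum_powerset_signedChoose_of_not_subset, mul_zero]
    intro hsub
    exact hSU (Subtype.ext (eq_of_subset_of_card_le hsub (by rw [S.2, U.2])).symm)
  · simp

/-! ### The kernel and the dimension count -/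

theorem binaryBurnside_mulVec_eq_zero {n : ℕ} {f : (Fin n → Fin 2) → ℝ}
    (hf : ∀ y, f (y + 1) = -f y) : (binaryBurnside n).mulVec f = 0 := by
  have hfin : ∀ a : Fin 2, a + 1 + 1 = a := by decide
  have h2 : ∀ y : Fin n → Fin 2, y + 1 + 1 = y := fun y => funext fun i => hfin (y i)
  funext x
  rw [binaryBurnside_mulVec, Pi.zero_apply]
  have hs : ∀ s : Equiv.Perm (Fin n), ∑ y ∈ invariantOnes s ∅, f y = 0 := by
    intro s
    -- Complementation preserves each fixed set F_s, so an odd function sums to zero on it.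
    have hmem : ∀ y ∈ invariantOnes s ∅, y + 1 ∈ invariantOnes s ∅ := by
      intro y hy
      simp only [mem_invariantOnes, Pi.add_apply, Pi.one_apply] at hy ⊢
      exact ⟨fun i => by rw [hy.1], by simp⟩
    have : ∑ y ∈ invariantOnes s ∅, f y = ∑ y ∈ invariantOnes s ∅, -f y :=
      sum_nbij' (· + 1) (· + 1) hmem hmem (fun y _ => h2 y) (fun y _ => h2 y)
        (fun y _ => by rw [hf, neg_neg])
    rw [sum_neg_distrib] at this
    linarith
  simp [hs]

/-- The extension of a function of the last `n` coordinates to a function on `C_2^{n+1}` that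
changes sign under complementation. -/
def oddExtension (n : ℕ) :
    ((Fin n → Fin 2) → ℝ) →ₗ[ℝ] ((Fin (n + 1) → Fin 2) → ℝ) where
  toFun φ x := if x 0 = 0 then φ (Fin.tail x) else -φ (Fin.tail (x + 1))
  map_add' φ ψ := by
    funext x
    simp only [Pi.add_apply]
    split_ifs <;> ring
  map_smul' c φ := by
    funext x
    simp only [Pi.smul_apply, smul_eq_mul, RingHom.id_apply]
    split_ifs <;> ring

theorem oddExtension_add_one {n : ℕ} (φ : (Fin n → Fin 2) → ℝ) (y : Fin (n + 1) → Fin 2) :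
    oddExtension n φ (y + 1) = -oddExtension n φ y := by
  have hfin : ∀ a : Fin 2, a + 1 + 1 = a := by decide
  have hfin' : ∀ a : Fin 2, (a + 1 = 0 ↔ ¬ a = 0) := by decide
  have h2 : y + 1 + 1 = y := funext fun i => hfin (y i)
  simp only [oddExtension, LinearMap.coe_mk, AddHom.coe_mk, h2, Pi.add_apply, Pi.one_apply, hfin']
  split_ifs <;> simp_all

theorem oddExtension_injective (n : ℕ) : Function.Injective (oddExtension n) := by
  intro φ ψ h
  funext w
  have := congrFun h (Fin.cons 0 w)
  simpa [oddExtension] using this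

theorem two_pow_le_finrank_eigenspace_zero (n : ℕ) :
    2 ^ n ≤ Module.finrank ℝ
      (Module.End.eigenspace (Matrix.toLin' (binaryBurnside (n + 1))) 0) := by
  have hmem : ∀ φ, oddExtension n φ ∈
      Module.End.eigenspace (Matrix.toLin' (binaryBurnside (n + 1))) 0 := by
    intro φ
    rw [Module.End.mem_eigenspace_iff, Matrix.toLin'_apply, zero_smul,
      binaryBurnside_mulVec_eq_zero (oddExtension_add_one φ)]
  have h := LinearMap.finrank_le_finrank_of_injective
    (f := (oddExtension n).codRestrict _ hmem)
    (fun φ ψ h => oddExtension_injective n (congrArg Subtype.val h))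
  simpa using h

theorem sum_range_choose_two_mul_succ (n K : ℕ) :
    ∑ k ∈ range (K + 1), (n + 1).choose (2 * k) = ∑ j ∈ range (2 * K + 1), n.choose j := by
  induction K with
  | zero => simp
  | succ K ih =>
    rw [sum_range_succ, ih, show 2 * (K + 1) + 1 = 2 * K + 1 + 1 + 1 by ring,
      sum_range_succ _ (2 * K + 1 + 1), sum_range_succ _ (2 * K + 1), show 2 * (K + 1) = 2 * K + 1 + 1 by ring,
      Nat.choose_succ_succ, add_assoc]

theorem sum_choose_two_mul (n : ℕ) :
    ∑ k ∈ range ((n + 1) / 2 + 1), (n + 1).choose (2 * k) = 2 ^ n := by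
  rw [sum_range_choose_two_mul_succ, ← Nat.sum_range_choose]
  refine (sum_subset (range_subset_range.2 (by omega)) fun j _ hj => ?_).symm
  exact Nat.choose_eq_zero_of_lt (by simpa using hj)

open Polynomial in
/-- If lower bounds for the dimensions of distinct eigenspaces add up to the dimension of the
space, then they are the exact geometric and algebraic multiplicities. -/
theorem charpoly_eq_prod_of_le_finrank_eigenspace {K V ι : Type*} [Field K] [AddCommGroup V]
    [Module K V] [FiniteDimensional K V] (T : Module.End K V) {E : Finset ι} {μ : ι → K}
    {m : ι → ℕ} (hμ : Set.InjOn μ E)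
    (hm : ∀ i ∈ E, m i ≤ Module.finrank K (T.eigenspace (μ i)))
    (hsum : ∑ i ∈ E, m i = Module.finrank K V) :
    T.charpoly = ∏ i ∈ E, (X - C (μ i)) ^ m i ∧
      ∀ i ∈ E, Module.finrank K (T.eigenspace (μ i)) = m i := by
  have hr : ∀ i ∈ E, Module.finrank K (T.eigenspace (μ i)) ≤ T.charpoly.rootMultiplicity (μ i) :=
    fun i _ => LinearMap.finrank_eigenspace_le T (μ i)
  have hmonic : ∀ r : ι → ℕ, (∏ i ∈ E, (X - C (μ i)) ^ r i).Monic :=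
    fun r => monic_prod_of_monic _ _ fun i _ => (monic_X_sub_C _).pow _
  have hdeg : ∀ r : ι → ℕ, (∏ i ∈ E, (X - C (μ i)) ^ r i).natDegree = ∑ i ∈ E, r i := by
    intro r
    rw [natDegree_prod_of_monic _ _ fun i _ => (monic_X_sub_C _).pow _]
    refine sum_congr rfl fun i _ => ?_
    rw [(monic_X_sub_C _).natDegree_pow, natDegree_X_sub_C, mul_one]
  have hdvd : ∏ i ∈ E, (X - C (μ i)) ^ T.charpoly.rootMultiplicity (μ i) ∣ T.charpoly := by
    refine Finset.prod_dvd_of_coprime (fun i hi j hj hij => ?_) fun i _ =>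
      pow_rootMultiplicity_dvd _ _
    exact (isCoprime_X_sub_C_of_isUnit_sub
      (sub_ne_zero.2 fun h => hij (hμ hi hj h)).isUnit).pow
  have hle := natDegree_le_of_dvd hdvd T.charpoly_monic.ne_zero
  rw [hdeg, LinearMap.charpoly_natDegree, ← hsum] at hle
  have heq := (sum_eq_sum_iff_of_le fun i hi => (hm i hi).trans (hr i hi)).1
    (le_antisymm (sum_le_sum fun i hi => (hm i hi).trans (hr i hi)) hle)
  refine ⟨?_, fun i hi => le_antisymm ((hr i hi).trans (heq i hi).ge) (hm i hi)⟩
  rw [prod_congr rfl fun i hi => by rw [← heq i hi]] at hdvd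
  exact (eq_of_monic_of_dvd_of_natDegree_le (hmonic m) T.charpoly_monic hdvd
    (by rw [hdeg, LinearMap.charpoly_natDegree, hsum]))

theorem signedChoose_mem_eigenspace {n k : ℕ} {S : Finset (Fin n)} (hS : S.card = 2 * k) :
    signedChoose S ∈ Module.End.eigenspace (Matrix.toLin' (binaryBurnside n))
      (burnsideEigenvalue k) := by
  rw [Module.End.mem_eigenspace_iff, Matrix.toLin'_apply, binaryBurnside_mulVec_signedChoose hS]

theorem linearIndependent_signedChoose_eigenspace (n k : ℕ) :
    LinearIndependent ℝ (fun S : {S : Finset (Fin n) // S.card = 2 * k} =>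
      (⟨signedChoose S.1, signedChoose_mem_eigenspace S.2⟩ :
        Module.End.eigenspace (Matrix.toLin' (binaryBurnside n)) (burnsideEigenvalue k))) :=
  LinearIndependent.of_comp (Submodule.subtype _) (linearIndependent_signedChoose n (2 * k))

theorem choose_le_finrank_eigenspace (n k : ℕ) :
    n.choose (2 * k) ≤ Module.finrank ℝ
      (Module.End.eigenspace (Matrix.toLin' (binaryBurnside n)) (burnsideEigenvalue k)) := by
  have h := (linearIndependent_signedChoose_eigenspace n k).fintype_card_le_finrank
  rwa [Fintype.card_finset_len, Fintype.card_fin] at h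

open Polynomial in
theorem binaryBurnside_charpoly_and_finrank_eigenspace {n : ℕ} (hn : 1 ≤ n) :
    (binaryBurnside n).charpoly = X ^ (2 ^ (n - 1)) *
      ∏ k ∈ range (n / 2 + 1), (X - C (burnsideEigenvalue k)) ^ (n.choose (2 * k)) ∧
    Module.finrank ℝ (Module.End.eigenspace (Matrix.toLin' (binaryBurnside n)) 0) =
      2 ^ (n - 1) ∧
    ∀ k ≤ n / 2, Module.finrank ℝ (Module.End.eigenspace (Matrix.toLin' (binaryBurnside n))
      (burnsideEigenvalue k)) = n.choose (2 * k) := by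
  obtain ⟨n, rfl⟩ := Nat.exists_eq_add_of_le' hn
  rw [Nat.add_sub_cancel]
  -- `none` indexes the eigenvalue 0 and `some k` indexes β_k.
  set E : Finset (Option ℕ) := insertNone (range ((n + 1) / 2 + 1)) with hE
  set μ : Option ℕ → ℝ := fun i => i.elim 0 burnsideEigenvalue with hμ
  set m : Option ℕ → ℕ := fun i => i.elim (2 ^ n) fun k => (n + 1).choose (2 * k) with hm
  have hinj : Set.InjOn μ E := by
    rintro (_ | i) _ (_ | j) _ h
    · rfl
    · exact absurd h.symm (burnsideEigenvalue_pos j).ne'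
    · exact absurd h (burnsideEigenvalue_pos i).ne'
    · exact congrArg some (burnsideEigenvalue_strictAnti.injective h)
  have hle : ∀ i ∈ E, m i ≤ Module.finrank ℝ
      (Module.End.eigenspace (Matrix.toLin' (binaryBurnside (n + 1))) (μ i)) := by
    rintro (_ | k) _
    · exact two_pow_le_finrank_eigenspace_zero n
    · exact choose_le_finrank_eigenspace (n + 1) k
  have hsum : ∑ i ∈ E, m i = Module.finrank ℝ ((Fin (n + 1) → Fin 2) → ℝ) := by
    rw [hE, sum_insertNone]
    simp only [hm, Option.elim_none, Option.elim_some, sum_choose_two_mul]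
    simp [pow_succ, mul_two]
  obtain ⟨hchar, hfin⟩ := charpoly_eq_prod_of_le_finrank_eigenspace _ hinj hle hsum
  refine ⟨?_, hfin none (by simp [hE]), fun k hk => hfin (some k) (by simp [hE]; omega)⟩
  rw [← Matrix.charpoly_toLin', hchar, hE, prod_insertNone]
  simp [hμ, hm]

theorem theorem1p2 (n : ℕ) (hn : 1 ≤ n) :
    -- the eigenvalues are exactly `0` and the nonzero numbers `β_k`, `0 ≤ k ≤ ⌊n/2⌋`
    (∀ μ : ℝ, Module.End.HasEigenvalue (Matrix.toLin' (binaryBurnside n)) μ ↔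
      μ = 0 ∨ ∃ k : ℕ, k ≤ n / 2 ∧ μ = burnsideEigenvalue k) ∧
    (∀ k : ℕ, k ≤ n / 2 → burnsideEigenvalue k ≠ 0) ∧
    -- algebraic multiplicities
    (binaryBurnside n).charpoly = Polynomial.X ^ (2 ^ (n - 1)) *
      ∏ k ∈ Finset.range (n / 2 + 1),
        (Polynomial.X - Polynomial.C (burnsideEigenvalue k)) ^ (n.choose (2 * k)) ∧
    -- geometric multiplicities
    Module.finrank ℝ (Module.End.eigenspace (Matrix.toLin' (binaryBurnside n)) 0) =
      2 ^ (n - 1) ∧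
    (∀ k : ℕ, k ≤ n / 2 →
      Module.finrank ℝ (Module.End.eigenspace (Matrix.toLin' (binaryBurnside n))
        (burnsideEigenvalue k)) = n.choose (2 * k)) ∧
    -- the functions `f_S`, `|S| = 2k`, form a basis of the `β_k`-eigenspace
    (∀ k : ℕ, k ≤ n / 2 →
      ∃ b : Module.Basis {S : Finset (Fin n) // S.card = 2 * k} ℝ
          (Module.End.eigenspace (Matrix.toLin' (binaryBurnside n)) (burnsideEigenvalue k)),
        ∀ (S : {S : Finset (Fin n) // S.card = 2 * k}) (x : Fin n → Fin 2),
          (b S : (Fin n → Fin 2) → ℝ) x =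
            (-1 : ℝ) ^ onesIn x S.1 * ((2 * k).choose (onesIn x S.1) : ℝ)) := by
  obtain ⟨hchar, hzero, hbeta⟩ := binaryBurnside_charpoly_and_finrank_eigenspace hn
  refine ⟨fun μ => ?_, fun k _ => (burnsideEigenvalue_pos k).ne', hchar, hzero, hbeta,
    fun k hk => ?_⟩
  · rw [Module.End.hasEigenvalue_iff_isRoot_charpoly, Matrix.charpoly_toLin', hchar,
      Polynomial.IsRoot.def, Polynomial.eval_mul, Polynomial.eval_prod, mul_eq_zero,
      prod_eq_zero_iff]
    -- A factor with exponent 0 would be 1 and contribute no root.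
    have hpos : ∀ k, k ≤ n / 2 → n.choose (2 * k) ≠ 0 :=
      fun k hk => (Nat.choose_pos (by omega)).ne'
    refine or_congr (by simp) (exists_congr fun k => ?_)
    rw [mem_range, Nat.lt_succ_iff]
    refine and_congr_right fun hk => ?_
    simp [hpos k hk, sub_eq_zero]
  · have : Nonempty {S : Finset (Fin n) // S.card = 2 * k} := by
      obtain ⟨S, -, hS⟩ := exists_subset_card_eq (s := (univ : Finset (Fin n))) (n := 2 * k)
        (by rw [card_univ, Fintype.card_fin]; omega)
      exact ⟨S, hS⟩
    refine ⟨basisOfLinearIndependentOfCardEqFinrank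
      (linearIndependent_signedChoose_eigenspace n k) ?_, fun S x => ?_⟩
    · rw [Fintype.card_finset_len, Fintype.card_fin, hbeta k hk]
    · rw [coe_basisOfLinearIndependentOfCardEqFinrank]
      change signedChoose S.1 x = _
      rw [signedChoose, S.2]
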